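/- Let $\mathcal H$ be a complex Hilbert space with an orthonormal basis $(|k\rangle)_{k\in\mathbb Z}$, let $Z$ be the selfadjoint operator with $Z|k\rangle=k|k\rangle$, and let $V_x=e^{ixZ}$ for $x\in\mathbb R$, so that $V_x|k\rangle=e^{ikx}|k\rangle$. A semispectral measure on $[0,2\pi)$ is a weakly countably additive map $E$ from the Borel subsets of $[0,2\pi)$ to the positive bounded operators on $\mathcal H$ with $E([0,2\pi))=I$. It is $\mathbb Z$-covariant (a box localization observable) if $V_xE(X)V_x^*=E(X\oplus x)$ for all Borel $X\subseteq[0,2\pi)$ and $x\in\mathbb R$, where $X\oplus x=\{y\in[0,2\pi): (y-x)\bmod 2\pi\in X\}$. A structure matrix of $E$ is a positive semidefinite matrix $B:\mathbb Z\times\mathbb Z\to\{z\in\mathbb C:|z|\le1\}$ with $B(k,k)=1$ for all $k$ such that $$\langle k|E(X)|l\rangle=B(k,l)\,\frac1{2\pi}\int_Xe^{i(k-l)x}\,dx\qquad(k,l\in\mathbb Z,\ X\subseteq[0,2\pi)\text{ Borel}).$$ Every such matrix $B$ is the structure matrix of a unique semispectral measure, denoted $E^B$; the canonical spectral measure $E^1$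 is the one with $B(k,l)=1$ for all $k,l$. Let $E^B$ be a $\mathbb Z$-covariant semispectral measure with structure matrix $B$. Then the following conditions are equivalent: (a) $E^B$ is noiseless: its noise operator $E^B[2]-E^B[1]^2$ is $0$, where $E^B[j]$ is the bounded operator with $\langle\varphi|E^B[j]\varphi\rangle=\int_0^{2\pi}x^j\,d\langle\varphi|E^B(x)\varphi\rangle$ for all $\varphi\in\mathcal H$; (b) $B$ is noiseless: for all $n\in\mathbb Z$ and all integers $l\ge0$, $$s_n^B(l)=M_n^{(l)}(1)-M_n^{(l)}(B)=0,\qquad M_n^{(l)}(C)=\sum_{k\in\mathbb Z}X_n^C(k)^l\,p_n(k),$$ where $p_n(k)=\frac{3}{\pi^2(k-n)^2}$ and $X_n^C(k)=\frac{\pi}{\sqrt3}|C(n,k)|$ for $k\ne n$, $p_n(n)=X_n^C(n)=0$, and $1$ denotes the matrix with all entries equal to $1$; (c) $|B(k,l)|=1$ for all $k,l\in\mathbb Z$; (d) $E^B$ is unitarily equivalent to $E^1$ as a covariance system: there is a unitary operator $U$ on $\mathcal H$ with $UE^B(X)U^*=E^1(X)$ for all Borel $X\subseteq[0,2\pi)$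 and $UV_xU^*=V_x$ for all $x\in\mathbb R$. -/

import Mathlib

open MeasureTheory
open scoped InnerProductSpace ComplexOrder

noncomputable section

namespace BoxLocalization

variable {H : Type*} [NormedAddCommGroup H] [InnerProductSpace ℂ H]

/-- The interval `[0, 2π)`, with its Borel sets and Lebesgue measure. -/
abbrev Box : Type := Set.Ico (0 : ℝ) (2 * Real.pi)

/-- Lebesgue measure on `[0, 2π)`. -/
instance : MeasureSpace Box := Measure.Subtype.measureSpace

/-- A semispectral measure (normalized positive operator measure) on the Borel subsets of
`[0, 2π)`: countably additive in the weak sense. -/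
structure SemispectralMeasure (H : Type*) [NormedAddCommGroup H] [InnerProductSpace ℂ H] where
  /-- The operator `E(X)`; as for Mathlib's vector measures, it is `0` on non-measurable sets. -/
  op : Set Box → H →L[ℂ] H
  op_not_measurable : ∀ X, ¬ MeasurableSet X → op X = 0
  op_pos : ∀ X, MeasurableSet X → (op X).IsPositive
  op_univ : op Set.univ = ContinuousLinearMap.id ℂ H
  op_iUnion : ∀ f : ℕ → Set Box, (∀ i, MeasurableSet (f i)) →
    Pairwise (Function.onFun Disjoint f) → ∀ φ ψ : H,
      HasSum (fun i => ⟪φ, op (f i) ψ⟫_ℂ) ⟪φ, op (⋃ i, f i) ψ⟫_ℂ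

namespace SemispectralMeasure

theorem op_empty (E : SemispectralMeasure H) : E.op ∅ = 0 := by
  ext ψ
  refine ext_inner_left ℂ fun φ => ?_
  have h := E.op_iUnion (fun _ => ∅) (fun _ => MeasurableSet.empty)
    (fun _ _ _ => disjoint_bot_left) φ ψ
  have h2 := h.summable.tendsto_atTop_zero
  simpa using tendsto_nhds_unique h2 tendsto_const_nhds |>.symm

theorem re_inner_nonneg (E : SemispectralMeasure H) (φ : H) (X : Set Box) :
    0 ≤ (⟪φ, E.op X φ⟫_ℂ).re := by
  by_cases hX : MeasurableSet X
  · exact (E.op_pos X hX).re_inner_nonneg_right φ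
  · simp [E.op_not_measurable X hX]

/-- The finite positive measure `X ↦ ⟨φ | E(X) φ⟩`. -/
def measure (E : SemispectralMeasure H) (φ : H) : Measure Box :=
  Measure.ofMeasurable (fun X _ => ENNReal.ofReal (⟪φ, E.op X φ⟫_ℂ).re)
    (by simp [E.op_empty])
    (by
      intro f hf hd
      have h := Complex.hasSum_re (E.op_iUnion f hf hd φ φ)
      rw [← h.tsum_eq, ENNReal.ofReal_tsum_of_nonneg (fun i => E.re_inner_nonneg φ (f i))
        h.summable])

theorem measure_apply (E : SemispectralMeasure H) (φ : H) {X : Set Box} (hX : MeasurableSet X) :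
    E.measure φ X = ENNReal.ofReal (⟪φ, E.op X φ⟫_ℂ).re :=
  Measure.ofMeasurable_apply X hX

theorem measure_real_univ (E : SemispectralMeasure H) (φ : H) :
    (E.measure φ).real Set.univ = ‖φ‖ ^ 2 := by
  rw [Measure.real, E.measure_apply φ MeasurableSet.univ,
    ENNReal.toReal_ofReal (E.re_inner_nonneg φ Set.univ), E.op_univ]
  simpa using inner_self_eq_norm_sq (𝕜 := ℂ) φ

instance (E : SemispectralMeasure H) (φ : H) : IsFiniteMeasure (E.measure φ) :=
  ⟨by rw [E.measure_apply φ MeasurableSet.univ]; exact ENNReal.ofReal_lt_top⟩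

/-- The operator of a simple function. -/
theorem exists_simple (E : SemispectralMeasure H) (g : SimpleFunc Box ℝ) :
    ∃ T : H →L[ℂ] H, ∀ φ, ⟪φ, T φ⟫_ℂ = ((∫ x, g x ∂(E.measure φ) : ℝ) : ℂ) := by
  refine ⟨∑ y ∈ g.range, (y : ℂ) • E.op (g ⁻¹' {y}), fun φ => ?_⟩
  have hi : Integrable g (E.measure φ) := SimpleFunc.integrable_of_isFiniteMeasure g
  rw [SimpleFunc.integral_eq_sum g hi, _root_.sum_apply, inner_sum,
    Complex.ofReal_sum]
  refine Finset.sum_congr rfl fun y _ => ?_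
  have hp := E.op_pos _ (g.measurableSet_fiber y)
  have : ((⟪φ, E.op (g ⁻¹' {y}) φ⟫_ℂ).re : ℂ) = ⟪φ, E.op (g ⁻¹' {y}) φ⟫_ℂ :=
    (RCLike.nonneg_iff_exists_ofReal.1 (hp.inner_nonneg_right φ)).elim
      fun r hr => by rw [← hr.2]; simp
  rw [Measure.real, E.measure_apply φ (g.measurableSet_fiber y),
    ENNReal.toReal_ofReal (E.re_inner_nonneg φ _), _root_.smul_apply,
    inner_smul_right, smul_eq_mul, Complex.ofReal_mul, this, mul_comm]

theorem norm_le_of_quadratic {T : H →L[ℂ] H} {C : ℝ} (hC : 0 ≤ C) (q : H → ℝ)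
    (hq : ∀ φ, ⟪φ, T φ⟫_ℂ = (q φ : ℂ)) (hb : ∀ φ, |q φ| ≤ C * ‖φ‖ ^ 2) : ‖T‖ ≤ C := by
  have hsymm : T.IsSymmetric := by
    refine (LinearMap.isSymmetric_iff_inner_map_self_real (T : H →ₗ[ℂ] H)).2 fun v => ?_
    rw [inner_conj_symm]
    have := hq v
    have h2 := inner_conj_symm (𝕜 := ℂ) (T v) v
    simp only [ContinuousLinearMap.coe_coe]
    rw [← h2, this, Complex.conj_ofReal]
  rw [ContinuousLinearMap.norm_eq_iSup_rayleighQuotient T hsymm]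
  refine ciSup_le fun x => ?_
  rw [ContinuousLinearMap.rayleighQuotient, ContinuousLinearMap.reApplyInnerSelf_apply, abs_div,
    abs_sq]
  have : RCLike.re ⟪T x, x⟫_ℂ = q x := by
    rw [← inner_conj_symm, hq x]; simp
  rw [this]
  exact div_le_of_le_mul₀ (sq_nonneg _) hC (hb x)

/-- The weak operator integral `∫ f dE` of a bounded measurable function exists. -/
theorem exists_integral [CompleteSpace H] (E : SemispectralMeasure H) (f : Box → ℝ)
    (hf : Measurable f) (C : ℝ) (hC : ∀ x, |f x| ≤ C) :
    ∃ T : H →L[ℂ] H, ∀ φ, ⟪φ, T φ⟫_ℂ = ((∫ x, f x ∂(E.measure φ) : ℝ) : ℂ) := by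
  have happ : ∀ n : ℕ, ∃ g : SimpleFunc Box ℝ, ∀ x, |f x - g x| ≤ 1 / ((n : ℝ) + 1) := by
    intro n
    have hn : (0 : ℝ) < (n : ℝ) + 1 := by positivity
    refine ⟨⟨fun x => (⌊((n : ℝ) + 1) * f x⌋ : ℝ) / ((n : ℝ) + 1), fun y => ?_, ?_⟩, fun x => ?_⟩
    · have : Measurable fun x => (⌊((n : ℝ) + 1) * f x⌋ : ℝ) / ((n : ℝ) + 1) := by fun_prop
      exact this (measurableSet_singleton y)
    · refine ((Set.finite_Icc (-⌈((n : ℝ) + 1) * C⌉ - 1) (⌈((n : ℝ) + 1) * C⌉ + 1)).image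
        (fun j : ℤ => (j : ℝ) / ((n : ℝ) + 1))).subset ?_
      rintro _ ⟨x, rfl⟩
      refine ⟨⌊((n : ℝ) + 1) * f x⌋, ⟨?_, ?_⟩, rfl⟩
      · rw [Int.le_floor]
        push_cast
        have h1 := Int.le_ceil (((n : ℝ) + 1) * C)
        have h2 := (abs_le.1 (hC x)).1
        nlinarith
      · have h1 : ((n : ℝ) + 1) * f x ≤ ((n : ℝ) + 1) * C :=
          mul_le_mul_of_nonneg_left (abs_le.1 (hC x)).2 hn.le
        have := (Int.floor_le_floor h1).trans (Int.floor_le_ceil _)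
        linarith
    · change |f x - (⌊((n : ℝ) + 1) * f x⌋ : ℝ) / ((n : ℝ) + 1)| ≤ 1 / ((n : ℝ) + 1)
      have h1 := Int.floor_le (((n : ℝ) + 1) * f x)
      have h2 := Int.lt_floor_add_one (((n : ℝ) + 1) * f x)
      have : f x - (⌊((n : ℝ) + 1) * f x⌋ : ℝ) / ((n : ℝ) + 1)
          = (((n : ℝ) + 1) * f x - ⌊((n : ℝ) + 1) * f x⌋) / ((n : ℝ) + 1) := by
        field_simp
      rw [this, abs_of_nonneg (div_nonneg (by linarith) hn.le)]
      exact div_le_div_of_nonneg_right (by linarith) hn.le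
  choose g hg using happ
  choose T hT using fun n => E.exists_simple (g n)
  have hgi : ∀ n φ, Integrable (g n) (E.measure φ) :=
    fun n φ => SimpleFunc.integrable_of_isFiniteMeasure _
  have hfi : ∀ φ, Integrable f (E.measure φ) := fun φ =>
    Integrable.of_bound hf.aestronglyMeasurable C (Filter.Eventually.of_forall hC)
  have hcauchy : CauchySeq T := by
    refine cauchySeq_of_le_tendsto_0 (fun N : ℕ => 2 * (1 / ((N : ℝ) + 1))) ?_ ?_
    · intro n m N hn hm
      rw [dist_eq_norm]
      have hN : (0 : ℝ) < (N : ℝ) + 1 := by positivity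
      have hn' : 1 / ((n : ℝ) + 1) ≤ 1 / ((N : ℝ) + 1) := by gcongr
      have hm' : 1 / ((m : ℝ) + 1) ≤ 1 / ((N : ℝ) + 1) := by gcongr
      refine norm_le_of_quadratic (by positivity)
        (fun φ => ∫ x, (g n x - g m x) ∂(E.measure φ)) (fun φ => ?_) (fun φ => ?_)
      · rw [integral_sub (hgi n φ) (hgi m φ), _root_.sub_apply, inner_sub_right, hT,
          hT]
        push_cast; ring
      · rw [← E.measure_real_univ φ, ← Real.norm_eq_abs]
        refine norm_integral_le_of_norm_le_const (Filter.Eventually.of_forall fun x => ?_)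
        have h1 := abs_le.1 (hg n x)
        have h2 := abs_le.1 (hg m x)
        rw [Real.norm_eq_abs, abs_le]
        constructor <;> linarith [h1.1, h1.2, h2.1, h2.2]
    · simpa using (tendsto_one_div_add_atTop_nhds_zero_nat (𝕜 := ℝ)).const_mul 2
  obtain ⟨S, hS⟩ := cauchySeq_tendsto_of_complete hcauchy
  refine ⟨S, fun φ => ?_⟩
  have hl : Filter.Tendsto (fun n => ⟪φ, T n φ⟫_ℂ) Filter.atTop (nhds ⟪φ, S φ⟫_ℂ) := by
    have h1 : Continuous fun A : H →L[ℂ] H => ⟪φ, A φ⟫_ℂ := by fun_prop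
    exact (h1.tendsto S).comp hS
  have hr : Filter.Tendsto (fun n => ∫ x, g n x ∂(E.measure φ)) Filter.atTop
      (nhds (∫ x, f x ∂(E.measure φ))) := by
    rw [tendsto_iff_dist_tendsto_zero]
    refine squeeze_zero (fun _ => dist_nonneg)
      (g := fun n : ℕ => 1 / ((n : ℝ) + 1) * (E.measure φ).real Set.univ) (fun n => ?_) ?_
    · rw [dist_comm, dist_eq_norm, ← integral_sub (hfi φ) (hgi n φ)]
      exact norm_integral_le_of_norm_le_const (Filter.Eventually.of_forall fun x => hg n x)
    · simpa using (tendsto_one_div_add_atTop_nhds_zero_nat (𝕜 := ℝ)).mul_const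
        ((E.measure φ).real Set.univ)
  refine tendsto_nhds_unique hl ?_
  simp_rw [hT]
  exact (Complex.continuous_ofReal.tendsto _).comp hr

theorem exists_moment [CompleteSpace H] (E : SemispectralMeasure H) (k : ℕ) :
    ∃ T : H →L[ℂ] H, ∀ φ, ⟪φ, T φ⟫_ℂ = ((∫ x, (x : ℝ) ^ k ∂(E.measure φ) : ℝ) : ℂ) := by
  refine E.exists_integral (fun x => (x : ℝ) ^ k) (by fun_prop) ((2 * Real.pi) ^ k) fun x => ?_
  rw [abs_of_nonneg (pow_nonneg x.2.1 k)]
  exact pow_le_pow_left₀ x.2.1 x.2.2.le k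

/-- The `k`-th moment operator `E[k] = ∫ x^k dE(x)`: the (unique) bounded operator with
`⟨φ | E[k] φ⟩ = ∫ x^k d⟨φ | E(x) φ⟩` for all vectors `φ`. -/
def moment [CompleteSpace H] (E : SemispectralMeasure H) (k : ℕ) : H →L[ℂ] H :=
  Classical.choose (E.exists_moment k)

theorem inner_moment [CompleteSpace H] (E : SemispectralMeasure H) (k : ℕ) (φ : H) :
    ⟪φ, E.moment k φ⟫_ℂ = ((∫ x, (x : ℝ) ^ k ∂(E.measure φ) : ℝ) : ℂ) :=
  Classical.choose_spec (E.exists_moment k) φ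

/-- The noise operator `E[2] - E[1]²`. -/
def noise [CompleteSpace H] (E : SemispectralMeasure H) : H →L[ℂ] H :=
  E.moment 2 - E.moment 1 ∘L E.moment 1

/-- `E` is noiseless if its noise operator vanishes. -/
def IsNoiseless [CompleteSpace H] (E : SemispectralMeasure H) : Prop := E.noise = 0

end SemispectralMeasure
/-- A normalized positive semidefinite matrix with entries in the closed unit disc. -/
structure IsNormalizedPSD (B : Matrix ℤ ℤ ℂ) : Prop where
  norm_le_one : ∀ k l, ‖B k l‖ ≤ 1
  diag : ∀ k, B k k = 1
  posSemidef : B.PosSemidef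

/-- `i_X(k, l) = (2π)⁻¹ ∫_X e^{i(k-l)x} dx`. -/
def boxFourier (X : Set Box) (k l : ℤ) : ℂ :=
  (1 / (2 * Real.pi) : ℂ) * ∫ x in X, Complex.exp (Complex.I * ((k : ℂ) - l) * ((x : ℝ) : ℂ))

/-- The entrywise product of `B` and `i_X`. -/
def boxMatrix (B : Matrix ℤ ℤ ℂ) (X : Set Box) : Matrix ℤ ℤ ℂ :=
  Matrix.of fun k l => B k l * boxFourier X k l

theorem boxMatrix_apply (B : Matrix ℤ ℤ ℂ) (X : Set Box) (k l : ℤ) :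
    boxMatrix B X k l = B k l * boxFourier X k l := rfl

instance : IsFiniteMeasure (volume : Measure Box) :=
  ⟨by rw [Measure.Subtype.volume_univ measurableSet_Ico.nullMeasurableSet]; exact measure_Ico_lt_top⟩

theorem posSemidef_finset {M : Matrix ℤ ℤ ℂ} (hM : M.PosSemidef) (s : Finset ℤ) (c : ℤ → ℂ) :
    0 ≤ ∑ i ∈ s, ∑ j ∈ s, star (c i) * M i j * c j := by
  have h := hM.2 (Finsupp.onFinset s (fun i => if i ∈ s then c i else 0) (by
    intro i hi; by_contra h; simp [h] at hi))
  rw [Finsupp.sum_of_support_subset _ Finsupp.support_onFinset_subset _ (by simp)] at h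
  refine h.trans_eq (Finset.sum_congr rfl fun i hi => ?_)
  rw [Finsupp.sum_of_support_subset _ Finsupp.support_onFinset_subset _ (by simp)]
  refine Finset.sum_congr rfl fun j hj => ?_
  simp [hi, hj]

theorem integrable_exp (X : Set Box) (k l : ℤ) : IntegrableOn (fun x : Box =>
    Complex.exp (Complex.I * ((k : ℂ) - l) * ((x : ℝ) : ℂ))) X := by
  refine Integrable.of_bound (by fun_prop) 1 (Filter.Eventually.of_forall fun x => ?_)
  rw [show Complex.I * ((k : ℂ) - l) * ((x : ℝ) : ℂ)
    = (((k - l : ℝ) * (x : ℝ) : ℝ) : ℂ) * Complex.I by push_cast; ring,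
    Complex.norm_exp_ofReal_mul_I]

theorem boxFourier_univ (k l : ℤ) : boxFourier Set.univ k l = if k = l then 1 else 0 := by
  have hpi : (Real.pi : ℂ) ≠ 0 := by exact_mod_cast Real.pi_ne_zero
  have h0 : (∫ x : Box in Set.univ, Complex.exp (Complex.I * ((k : ℂ) - l) * ((x : ℝ) : ℂ)))
      = ∫ x in (0 : ℝ)..(2 * Real.pi), Complex.exp (Complex.I * ((k : ℂ) - l) * (x : ℂ)) := by
    rw [setIntegral_univ, intervalIntegral.integral_of_le (by positivity),
      ← integral_Ico_eq_integral_Ioc]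
    exact integral_subtype measurableSet_Ico
      (fun x : ℝ => Complex.exp (Complex.I * ((k : ℂ) - l) * (x : ℂ)))
  rw [boxFourier, h0]
  split_ifs with h
  · subst h
    simp
    field_simp
  · have hc : Complex.I * ((k : ℂ) - l) ≠ 0 :=
      mul_ne_zero Complex.I_ne_zero (sub_ne_zero.2 (by exact_mod_cast h))
    rw [integral_exp_mul_complex hc]
    have : Complex.exp (Complex.I * ((k : ℂ) - l) * ((2 * Real.pi : ℝ) : ℂ)) = 1 := by
      rw [Complex.exp_eq_one_iff]
      exact ⟨k - l, by push_cast; ring⟩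
    rw [this]; simp

theorem boxMatrix_univ {B : Matrix ℤ ℤ ℂ} (hB : IsNormalizedPSD B) :
    boxMatrix B Set.univ = 1 := by
  ext k l
  rw [boxMatrix_apply, boxFourier_univ, Matrix.one_apply]
  split_ifs with h
  · subst h; simp [hB.diag]
  · simp

theorem boxMatrix_posSemidef {B : Matrix ℤ ℤ ℂ} (hB : IsNormalizedPSD B) (X : Set Box) :
    (boxMatrix B X).PosSemidef := by
  have hpi : (Real.pi : ℂ) ≠ 0 := by exact_mod_cast Real.pi_ne_zero
  constructor
  · ext k l
    rw [Matrix.conjTranspose_apply, boxMatrix_apply, boxMatrix_apply, star_mul', hB.posSemidef.1.apply]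
    congr 1
    rw [boxFourier, boxFourier, star_mul']
    congr 1
    · simp
    · rw [Complex.star_def, ← integral_conj]
      congr 1
      ext x
      rw [← Complex.exp_conj]
      congr 1
      simp
      ring
  · intro c
    have key : (c.sum fun i xi => c.sum fun j xj => star xi * boxMatrix B X i j * xj)
        = (1 / (2 * Real.pi) : ℂ) * ∫ x : Box in X, ∑ i ∈ c.support, ∑ j ∈ c.support,
          star (c i) * B i j * c j * Complex.exp (Complex.I * ((i : ℂ) - j) * ((x : ℝ) : ℂ)) := by
      rw [integral_finsetSum _ fun i _ => integrable_finsetSum _ fun j _ =>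
        (integrable_exp X i j).const_mul _, Finset.mul_sum]
      refine Finset.sum_congr rfl fun i _ => ?_
      rw [integral_finsetSum _ fun j _ => (integrable_exp X i j).const_mul _, Finset.mul_sum]
      refine Finset.sum_congr rfl fun j _ => ?_
      change star (c i) * boxMatrix B X i j * c j = _
      rw [integral_const_mul, boxMatrix_apply, boxFourier]
      ring
    rw [key]
    refine mul_nonneg ?_ ?_
    · have : (0 : ℝ) ≤ 1 / (2 * Real.pi) := by positivity
      exact_mod_cast this
    · have hnn : ∀ x : Box, 0 ≤ ∑ i ∈ c.support, ∑ j ∈ c.support,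
          star (c i) * B i j * c j * Complex.exp (Complex.I * ((i : ℂ) - j) * ((x : ℝ) : ℂ)) := by
        intro x
        refine (posSemidef_finset hB.posSemidef c.support
          (fun i => c i * Complex.exp (-Complex.I * i * ((x : ℝ) : ℂ)))).trans_eq
          (Finset.sum_congr rfl fun i _ => Finset.sum_congr rfl fun j _ => ?_)
        simp only [star_mul', Complex.star_def]
        rw [← Complex.exp_conj,
          show Complex.I * ((i : ℂ) - j) * ((x : ℝ) : ℂ)
            = (starRingEnd ℂ) (-Complex.I * i * ((x : ℝ) : ℂ)) + -Complex.I * j * ((x : ℝ) : ℂ) by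
            simp; ring, Complex.exp_add]
        ring
      exact integral_nonneg hnn


theorem boxFourier_iUnion (f : ℕ → Set Box) (hf : ∀ i, MeasurableSet (f i))
    (hd : Pairwise (Function.onFun Disjoint f)) (k l : ℤ) :
    HasSum (fun i => boxFourier (f i) k l) (boxFourier (⋃ i, f i) k l) :=
  (hasSum_integral_iUnion hf hd (integrable_exp _ k l)).mul_left _

theorem boxFourier_union {X Y : Set Box} (hY : MeasurableSet Y) (hd : Disjoint X Y) (k l : ℤ) :
    boxFourier (X ∪ Y) k l = boxFourier X k l + boxFourier Y k l := by
  rw [boxFourier, setIntegral_union hd hY (integrable_exp _ k l) (integrable_exp _ k l), mul_add]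
  rfl

theorem one_sub_boxMatrix_posSemidef {B : Matrix ℤ ℤ ℂ} (hB : IsNormalizedPSD B) {X : Set Box}
    (hX : MeasurableSet X) : (1 - boxMatrix B X).PosSemidef := by
  have : 1 - boxMatrix B X = boxMatrix B Xᶜ := by
    rw [← boxMatrix_univ hB, sub_eq_iff_eq_add']
    ext k l
    rw [Matrix.add_apply, boxMatrix_apply, boxMatrix_apply, boxMatrix_apply, ← mul_add,
      ← boxFourier_union hX.compl disjoint_compl_right, Set.union_compl_self]
  rw [this]
  exact boxMatrix_posSemidef hB _

theorem dense_linearCombination (b : HilbertBasis ℤ ℂ H) :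
    DenseRange (Finsupp.linearCombination ℂ (b : ℤ → H)) := by
  have h := b.dense_span
  rw [← Finsupp.range_linearCombination] at h
  rw [DenseRange, ← LinearMap.coe_range]
  exact (Submodule.dense_iff_topologicalClosure_eq_top).2 h

theorem norm_sq_linearCombination (b : HilbertBasis ℤ ℂ H) (d : ℤ →₀ ℂ) {s : Finset ℤ}
    (hs : d.support ⊆ s) :
    ‖Finsupp.linearCombination ℂ (b : ℤ → H) d‖ ^ 2 = ∑ k ∈ s, ‖d k‖ ^ 2 := by
  have h : ((‖Finsupp.linearCombination ℂ (b : ℤ → H) d‖ : ℂ)) ^ 2 = ∑ k ∈ s, (‖d k‖ : ℂ) ^ 2 := by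
    have := inner_self_eq_norm_sq_to_K (𝕜 := ℂ) (Finsupp.linearCombination ℂ (b : ℤ → H) d)
    refine this.symm.trans ?_
    rw [b.orthonormal.inner_finsupp_eq_sum_left, Finsupp.sum_of_support_subset _ hs _ (by simp)]
    exact Finset.sum_congr rfl fun k _ => RCLike.conj_mul _
  exact_mod_cast h

/-- The coordinates of `M d` are square summable, with norm at most that of `d`. -/
theorem sum_norm_sq_le {M : Matrix ℤ ℤ ℂ} (hM : M.PosSemidef) (hM1 : (1 - M).PosSemidef)
    (b : HilbertBasis ℤ ℂ H) (d : ℤ →₀ ℂ) (s : Finset ℤ) :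
    ∑ k ∈ s, ‖d.sum fun l z => M k l * z‖ ^ 2
      ≤ ‖Finsupp.linearCombination ℂ (b : ℤ → H) d‖ ^ 2 := by
  classical
  set t := s ∪ d.support
  have hd : d.support ⊆ t := Finset.subset_union_right
  set v : ℤ → ℂ := fun k => d.sum fun l z => M k l * z
  have hv : ∀ k, v k = ∑ l ∈ t, M k l * d l := fun k =>
    Finsupp.sum_of_support_subset _ hd _ (by simp)
  refine (Finset.sum_le_sum_of_subset_of_nonneg Finset.subset_union_left
    fun _ _ _ => sq_nonneg _).trans (?_ : ∑ k ∈ t, ‖v k‖ ^ 2 ≤ _)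
  rw [norm_sq_linearCombination b d hd]
  have hvd : ∑ i ∈ t, ∑ j ∈ t, star (v i) * M i j * d j = ((∑ k ∈ t, ‖v k‖ ^ 2 : ℝ) : ℂ) := by
    push_cast
    refine Finset.sum_congr rfl fun i _ => ?_
    simp_rw [mul_assoc]
    rw [← Finset.mul_sum, ← hv i]
    exact RCLike.conj_mul _
  have hdv : ∑ i ∈ t, ∑ j ∈ t, star (d i) * M i j * v j = ((∑ k ∈ t, ‖v k‖ ^ 2 : ℝ) : ℂ) := by
    have h := congrArg star hvd
    rw [Complex.star_def, Complex.conj_ofReal] at h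
    rw [← h, map_sum, Finset.sum_comm]
    refine Finset.sum_congr rfl fun i _ => ?_
    rw [map_sum]
    refine Finset.sum_congr rfl fun j _ => ?_
    rw [← hM.1.apply j i]
    simp only [map_mul, Complex.star_def, Complex.conj_conj]
    ring
  have h1 : ∀ c : ℤ → ℂ, (∑ i ∈ t, ∑ j ∈ t, star (c i) * M i j * c j).re
      ≤ ∑ k ∈ t, ‖c k‖ ^ 2 := by
    intro c
    have h := (Complex.le_def.1 (posSemidef_finset hM1 t c)).1
    have e : ∑ i ∈ t, ∑ j ∈ t, star (c i) * (1 - M) i j * c j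
        = ((∑ k ∈ t, ‖c k‖ ^ 2 : ℝ) : ℂ) - ∑ i ∈ t, ∑ j ∈ t, star (c i) * M i j * c j := by
      push_cast
      rw [← Finset.sum_sub_distrib]
      refine Finset.sum_congr rfl fun i hi => ?_
      simp_rw [Matrix.sub_apply, mul_sub, sub_mul]
      rw [Finset.sum_sub_distrib]
      congr 1
      simp only [Matrix.one_apply, mul_ite, mul_one, mul_zero, ite_mul, zero_mul]
      rw [Finset.sum_ite_eq, if_pos hi]
      exact RCLike.conj_mul _
    rw [e, Complex.sub_re, Complex.ofReal_re, Complex.zero_re] at h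
    linarith
  have h2 := (Complex.le_def.1 (posSemidef_finset hM t (fun k => v k - d k))).1
  have e2 : ∑ i ∈ t, ∑ j ∈ t, star (v i - d i) * M i j * (v j - d j)
      = (∑ i ∈ t, ∑ j ∈ t, star (v i) * M i j * v j)
        - (∑ i ∈ t, ∑ j ∈ t, star (v i) * M i j * d j)
        - (∑ i ∈ t, ∑ j ∈ t, star (d i) * M i j * v j)
        + ∑ i ∈ t, ∑ j ∈ t, star (d i) * M i j * d j := by
    simp only [← Finset.sum_sub_distrib, ← Finset.sum_add_distrib]
    refine Finset.sum_congr rfl fun i _ => Finset.sum_congr rfl fun j _ => ?_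
    rw [star_sub]; ring
  rw [e2, hvd, hdv] at h2
  simp only [Complex.zero_re, Complex.add_re, Complex.sub_re, Complex.ofReal_re] at h2
  linarith [h1 v, h1 d]

theorem ext_matrix (b : HilbertBasis ℤ ℂ H) {S T : H →L[ℂ] H}
    (h : ∀ k l, ⟪b k, S (b l)⟫_ℂ = ⟪b k, T (b l)⟫_ℂ) : S = T := by
  refine ContinuousLinearMap.ext_on
    ((Submodule.dense_iff_topologicalClosure_eq_top).2 b.dense_span) ?_
  rintro _ ⟨l, rfl⟩
  apply b.repr.injective
  ext k
  rw [b.repr_apply_apply, b.repr_apply_apply, h]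

/-- A matrix with `0 ≤ M ≤ 1` is the matrix of a positive contraction. -/
theorem exists_operator [CompleteSpace H] (b : HilbertBasis ℤ ℂ H) {M : Matrix ℤ ℤ ℂ}
    (hM : M.PosSemidef) (hM1 : (1 - M).PosSemidef) :
    ∃ T : H →L[ℂ] H, (∀ k l, ⟪b k, T (b l)⟫_ℂ = M k l) ∧ T.IsPositive ∧ ‖T‖ ≤ 1 := by
  classical
  have hmem : ∀ d : ℤ →₀ ℂ, Memℓp (fun k => d.sum fun l z => M k l * z) 2 := fun d =>
    memℓp_gen' (C := ‖Finsupp.linearCombination ℂ (b : ℤ → H) d‖ ^ 2) fun s => by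
      simpa using sum_norm_sq_le hM hM1 b d s
  let L : (ℤ →₀ ℂ) →ₗ[ℂ] H := b.repr.symm.toLinearEquiv.toLinearMap ∘ₗ
    { toFun := fun d => (⟨_, hmem d⟩ : lp (fun _ : ℤ => ℂ) 2)
      map_add' := fun c d => by
        ext k
        exact Finsupp.sum_add_index' (by simp) (by intros; ring)
      map_smul' := fun a d => by
        ext k
        refine (Finsupp.sum_smul_index (by simp)).trans ?_
        simp only [RingHom.id_apply, lp.coeFn_smul, Pi.smul_apply, smul_eq_mul]
        rw [Finsupp.mul_sum]
        exact Finset.sum_congr rfl fun _ _ => by ring }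
  have hL : ∀ d k, ⟪b k, L d⟫_ℂ = d.sum fun l z => M k l * z := fun d k => by
    rw [← b.repr_apply_apply]
    simp [L]
  have hbound : ∀ d, ‖L d‖ ≤ 1 * ‖Finsupp.linearCombination ℂ (b : ℤ → H) d‖ := fun d => by
    rw [one_mul, ← b.repr.norm_map]
    refine lp.norm_le_of_forall_sum_le (by simp) (norm_nonneg _) fun s => ?_
    have : ∀ k, b.repr (L d) k = d.sum fun l z => M k l * z := fun k => by
      rw [b.repr_apply_apply, hL]
    simpa [this] using sum_norm_sq_le hM hM1 b d s
  have hdense := dense_linearCombination b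
  set T : H →L[ℂ] H := L.extendOfNorm (Finsupp.linearCombination ℂ (b : ℤ → H)) with hT
  have hTe : ∀ d, T (Finsupp.linearCombination ℂ (b : ℤ → H) d) = L d :=
    LinearMap.extendOfNorm_eq hdense ⟨1, hbound⟩
  have hmat : ∀ k l, ⟪b k, T (b l)⟫_ℂ = M k l := fun k l => by
    have := hTe (Finsupp.single l 1)
    rw [Finsupp.linearCombination_single, one_smul] at this
    rw [this, hL]
    simp
  refine ⟨T, hmat, ⟨?_, fun x => ?_⟩, ?_⟩
  · have : T = ContinuousLinearMap.adjoint T := ext_matrix b fun k l => by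
      rw [ContinuousLinearMap.adjoint_inner_right, hmat, ← inner_conj_symm, hmat]
      exact (hM.1.apply k l).symm
    exact (ContinuousLinearMap.isSelfAdjoint_iff_isSymmetric).1 this.symm
  · refine hdense.induction_on (p := fun x => 0 ≤ T.reApplyInnerSelf x) x
      (isClosed_le continuous_const T.reApplyInnerSelf_continuous) fun d => ?_
    rw [ContinuousLinearMap.reApplyInnerSelf_apply, ← inner_re_symm, hTe,
      Finsupp.linearCombination_apply, Finsupp.sum_inner]
    have := (Complex.le_def.1 (hM.2 d)).1
    convert! this using 2
    refine Finset.sum_congr rfl fun i _ => ?_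
    simp only [inner_smul_left, hL]
    rw [Finsupp.mul_sum]
    exact Finset.sum_congr rfl fun _ _ => (mul_assoc _ _ _).symm
  · exact T.opNorm_le_bound zero_le_one
      (LinearMap.norm_extendOfNorm_apply_le hdense 1 hbound)

/-- The operator whose matrix in the basis `b` is the entrywise product of `B` and `i_X`. -/
theorem exists_boxOperator [CompleteSpace H] (b : HilbertBasis ℤ ℂ H) {B : Matrix ℤ ℤ ℂ}
    (hB : IsNormalizedPSD B) (X : Set Box) : ∃ T : H →L[ℂ] H,
      (MeasurableSet X → ∀ k l, ⟪b k, T (b l)⟫_ℂ = B k l * boxFourier X k l) ∧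
      (¬ MeasurableSet X → T = 0) ∧ T.IsPositive ∧ ‖T‖ ≤ 1 := by
  by_cases hX : MeasurableSet X
  · obtain ⟨T, h1, h2, h3⟩ := exists_operator b (boxMatrix_posSemidef hB X)
      (one_sub_boxMatrix_posSemidef hB hX)
    exact ⟨T, fun _ => h1, fun h => (h hX).elim, h2, h3⟩
  · exact ⟨0, fun h => (hX h).elim, fun _ => rfl, ContinuousLinearMap.isPositive_zero, by simp⟩

theorem tendsto_weak {ι : Type*} {F : Filter ι} (b : HilbertBasis ℤ ℂ H) (A : ι → H →L[ℂ] H)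
    (hA : ∀ i, ‖A i‖ ≤ 1) (T : H →L[ℂ] H)
    (h : ∀ k l, Filter.Tendsto (fun i => ⟪b k, A i (b l)⟫_ℂ) F (nhds ⟪b k, T (b l)⟫_ℂ)) (φ ψ : H) :
    Filter.Tendsto (fun i => ⟪φ, A i ψ⟫_ℂ) F (nhds ⟪φ, T ψ⟫_ℂ) := by
  have hspan : ∀ x : H, x ∈ closure (Submodule.span ℂ (Set.range b) : Set H) :=
    (Submodule.dense_iff_topologicalClosure_eq_top).2 b.dense_span
  have hle : ∀ i φ ψ, ‖⟪φ, A i ψ⟫_ℂ‖ ≤ ‖φ‖ * ‖ψ‖ := fun i φ ψ =>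
    (norm_inner_le_norm _ _).trans (mul_le_mul_of_nonneg_left
      (((A i).le_opNorm ψ).trans (mul_le_of_le_one_left (norm_nonneg _) (hA i))) (norm_nonneg _))
  have step1 : ∀ k ψ, Filter.Tendsto (fun i => ⟪b k, A i ψ⟫_ℂ) F (nhds ⟪b k, T ψ⟫_ℂ) := by
    intro k ψ
    have heq : Equicontinuous fun i (ψ : H) => ⟪b k, A i ψ⟫_ℂ :=
      (LipschitzWith.uniformEquicontinuous _ 1 fun i => LipschitzWith.of_dist_le_mul fun x y => by
        rw [dist_eq_norm, dist_eq_norm, ← inner_sub_right, ← map_sub]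
        refine (hle i (b k) (x - y)).trans_eq ?_
        rw [b.orthonormal.norm_eq_one k, NNReal.coe_one]).equicontinuous
    refine closure_minimal (t := {ψ | Filter.Tendsto (fun i => ⟪b k, A i ψ⟫_ℂ) F
      (nhds ⟪b k, T ψ⟫_ℂ)}) (fun x hx => ?_)
      (heq.isClosed_setOfPred_tendsto (f := fun ψ => ⟪b k, T ψ⟫_ℂ) (by fun_prop)) (hspan ψ)
    refine Submodule.span_induction (p := fun x _ => Filter.Tendsto (fun i => ⟪b k, A i x⟫_ℂ) F
      (nhds ⟪b k, T x⟫_ℂ)) ?_ ?_ ?_ ?_ hx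
    · rintro _ ⟨l, rfl⟩; exact h k l
    · simpa using tendsto_const_nhds
    · intro x y _ _ hx hy; simpa [inner_add_right] using hx.add hy
    · intro a x _ hx; simpa [inner_smul_right] using hx.const_mul a
  have heq : Equicontinuous fun i (φ : H) => ⟪φ, A i ψ⟫_ℂ :=
    (LipschitzWith.uniformEquicontinuous _ ‖ψ‖₊ fun i => LipschitzWith.of_dist_le_mul fun x y => by
      rw [dist_eq_norm, dist_eq_norm, ← inner_sub_left, mul_comm]
      exact hle i (x - y) ψ).equicontinuous
  refine closure_minimal (t := {φ | Filter.Tendsto (fun i => ⟪φ, A i ψ⟫_ℂ) F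
    (nhds ⟪φ, T ψ⟫_ℂ)}) (fun x hx => ?_)
    (heq.isClosed_setOfPred_tendsto (f := fun φ => ⟪φ, T ψ⟫_ℂ) (by fun_prop)) (hspan φ)
  refine Submodule.span_induction (p := fun x _ => Filter.Tendsto (fun i => ⟪x, A i ψ⟫_ℂ) F
    (nhds ⟪x, T ψ⟫_ℂ)) ?_ ?_ ?_ ?_ hx
  · rintro _ ⟨l, rfl⟩; exact step1 l ψ
  · simpa using tendsto_const_nhds
  · intro x y _ _ hx hy; simpa [inner_add_left] using hx.add hy
  · intro a x _ hx; simpa [inner_smul_left] using hx.mul_const _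

/-- The semispectral measure `E^B` with `⟨k | E^B(X) | l⟩ = B(k, l) i_X(k, l)`. -/
def boxObservable [CompleteSpace H] (b : HilbertBasis ℤ ℂ H) (B : Matrix ℤ ℤ ℂ)
    (hB : IsNormalizedPSD B) : SemispectralMeasure H where
  op X := Classical.choose (exists_boxOperator b hB X)
  op_not_measurable X := (Classical.choose_spec (exists_boxOperator b hB X)).2.1
  op_pos X _ := (Classical.choose_spec (exists_boxOperator b hB X)).2.2.1
  op_univ := ext_matrix b fun k l => by
    rw [(Classical.choose_spec (exists_boxOperator b hB Set.univ)).1 MeasurableSet.univ,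
      ← boxMatrix_apply, boxMatrix_univ hB, Matrix.one_apply]
    exact (orthonormal_iff_ite.1 b.orthonormal k l).symm
  op_iUnion f hf hd φ ψ := by
    have spec := fun X => Classical.choose_spec (exists_boxOperator b hB X)
    set T : Set Box → H →L[ℂ] H := fun X => Classical.choose (exists_boxOperator b hB X)
    have hval : ∀ i k l, ⟪b k, T (f i) (b l)⟫_ℂ = B k l * boxFourier (f i) k l :=
      fun i => (spec (f i)).1 (hf i)
    have hfin : ∀ s : Finset ℕ, ∑ i ∈ s, T (f i) = T (⋃ i ∈ s, f i) := fun s =>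
      ext_matrix b fun k l => by
        rw [show ⟪b k, T (⋃ i ∈ s, f i) (b l)⟫_ℂ = _ from
          (spec _).1 (s.measurableSet_biUnion fun i _ => hf i) k l, _root_.sum_apply, inner_sum]
        simp_rw [hval]
        rw [boxFourier, integral_biUnion_finset s (fun i _ => hf i)
          (fun i _ j _ hij => hd hij) (fun i _ => integrable_exp _ k l), Finset.mul_sum, Finset.mul_sum]
        rfl
    have h := tendsto_weak (F := Filter.atTop) b (fun s : Finset ℕ => ∑ i ∈ s, T (f i))
      (fun s => by rw [hfin]; exact (spec _).2.2.2) (T (⋃ i, f i)) (fun k l => by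
        simp_rw [_root_.sum_apply, inner_sum]
        simp_rw [hval]
        rw [show ⟪b k, T (⋃ i, f i) (b l)⟫_ℂ = _ from (spec _).1 (MeasurableSet.iUnion hf) k l]
        exact (boxFourier_iUnion f hf hd k l).mul_left (B k l)) φ ψ
    simp_rw [_root_.sum_apply, inner_sum] at h
    exact h

/-- `B` is the structure matrix of `E` with respect to the basis `b`: it is normalized and positive
semidefinite with entries in the unit disc, and `E(X) = ∑ B(k, l) i_X(k, l) |k⟩⟨l|` weakly. -/
structure IsStructureMatrix (b : HilbertBasis ℤ ℂ H) (E : SemispectralMeasure H)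
    (B : Matrix ℤ ℤ ℂ) : Prop where
  normalizedPSD : IsNormalizedPSD B
  inner_op : ∀ X, MeasurableSet X → ∀ k l, ⟪b k, E.op X (b l)⟫_ℂ = B k l * boxFourier X k l

theorem boxObservable_isStructureMatrix [CompleteSpace H] (b : HilbertBasis ℤ ℂ H)
    (B : Matrix ℤ ℤ ℂ) (hB : IsNormalizedPSD B) : IsStructureMatrix b (boxObservable b B hB) B :=
  ⟨hB, fun X => (Classical.choose_spec (exists_boxOperator b hB X)).1⟩

/-- The matrix `B¹` with all entries equal to one. -/
def oneMatrix : Matrix ℤ ℤ ℂ := Matrix.of fun _ _ => 1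

theorem oneMatrix_isNormalizedPSD : IsNormalizedPSD oneMatrix where
  norm_le_one _ _ := by simp [oneMatrix]
  diag _ := rfl
  posSemidef := by
    refine ⟨by ext; simp [oneMatrix], fun c => ?_⟩
    have : (c.sum fun i xi => c.sum fun j xj => star xi * oneMatrix i j * xj)
        = star (c.sum fun _ x => x) * c.sum fun _ x => x := by
      simp only [oneMatrix, Matrix.of_apply, mul_one, Finsupp.sum, star_sum]
      rw [Finset.sum_mul_sum]
    rw [this]
    exact star_mul_self_nonneg _

/-- The canonical spectral measure `E¹`. -/
def canonicalObservable [CompleteSpace H] (b : HilbertBasis ℤ ℂ H) : SemispectralMeasure H :=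
  boxObservable b oneMatrix oneMatrix_isNormalizedPSD

/-- The basis `(e^{ikx} |k⟩)`. -/
def phaseBasis [CompleteSpace H] (b : HilbertBasis ℤ ℂ H) (x : ℝ) : HilbertBasis ℤ ℂ H :=
  HilbertBasis.mk (v := fun k : ℤ => Complex.exp (Complex.I * (x : ℂ) * (k : ℂ)) • b k)
    (by
      rw [orthonormal_iff_ite]
      intro k l
      rw [inner_smul_left, inner_smul_right, orthonormal_iff_ite.1 b.orthonormal k l]
      split_ifs with h
      · subst h
        rw [mul_one, ← Complex.exp_conj, ← Complex.exp_add]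
        simp
      · simp)
    (by
      rw [← b.dense_span]
      refine Submodule.topologicalClosure_mono (Submodule.span_le.2 ?_)
      rintro _ ⟨k, rfl⟩
      have h := Submodule.smul_mem _ (Complex.exp (Complex.I * (x : ℂ) * (k : ℂ)))⁻¹
        (Submodule.subset_span (R := ℂ) (Set.mem_range_self
          (f := fun k : ℤ => Complex.exp (Complex.I * (x : ℂ) * (k : ℂ)) • b k) k))
      rwa [inv_smul_smul₀ (Complex.exp_ne_zero _)] at h)

/-- The unitary operator `V_x = e^{ixZ}`, where `Z |k⟩ = k |k⟩`; that is,
`V_x |k⟩ = e^{ikx} |k⟩`. -/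
def translation [CompleteSpace H] (b : HilbertBasis ℤ ℂ H) (x : ℝ) : H ≃ₗᵢ[ℂ] H :=
  b.repr.trans (phaseBasis b x).repr.symm

theorem translation_apply [CompleteSpace H] (b : HilbertBasis ℤ ℂ H) (x : ℝ) (k : ℤ) :
    translation b x (b k) = Complex.exp (Complex.I * (x : ℂ) * (k : ℂ)) • b k := by
  classical
  rw [translation, LinearIsometryEquiv.trans_apply, b.repr_self, HilbertBasis.repr_symm_single,
    phaseBasis, HilbertBasis.coe_mk]

/-- The operator `U T U*`. -/
def conjugate (U : H ≃ₗᵢ[ℂ] H) (T : H →L[ℂ] H) : H →L[ℂ] H :=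
  (U : H →L[ℂ] H) ∘L T ∘L (U.symm : H →L[ℂ] H)

/-- The translate `X ⊕ x = {y ∈ [0, 2π) | (y - x) mod 2π ∈ X}`. -/
def boxTranslate (X : Set Box) (x : ℝ) : Set Box :=
  {y | (⟨toIcoMod Real.two_pi_pos 0 ((y : ℝ) - x), toIcoMod_mem_Ico' Real.two_pi_pos _⟩ : Box) ∈ X}

/-- `E` is `ℤ`-covariant: `V_x E(X) V_x* = E(X ⊕ x)`. -/
def IsCovariant [CompleteSpace H] (b : HilbertBasis ℤ ℂ H) (E : SemispectralMeasure H) : Prop :=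
  ∀ X, MeasurableSet X → ∀ x : ℝ,
    conjugate (translation b x) (E.op X) = E.op (boxTranslate X x)

/-- Unitary equivalence of `E` and `F` as covariance systems with the representation `x ↦ V_x`:
some unitary operator intertwines the two measures and the representation with itself. -/
def IsUnitarilyEquivalent [CompleteSpace H] (b : HilbertBasis ℤ ℂ H)
    (E F : SemispectralMeasure H) : Prop :=
  ∃ U : H ≃ₗᵢ[ℂ] H, (∀ X, MeasurableSet X → conjugate U (E.op X) = F.op X) ∧
    ∀ x : ℝ, conjugate U (translation b x : H →L[ℂ] H) = (translation b x : H →L[ℂ] H)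

/-- The probability `p_n({k})`. -/
def prob (n k : ℤ) : ℝ :=
  if k = n then 0 else 3 / (Real.pi ^ 2 * ((k : ℝ) - n) ^ 2)

/-- The random variable `X_n^B`. -/
def randomVar (B : Matrix ℤ ℤ ℂ) (n k : ℤ) : ℝ :=
  if k = n then 0 else Real.pi / √3 * ‖B n k‖

/-- The `l`-th moment of `X_n^B` with respect to `p_n`. -/
def matrixMoment (B : Matrix ℤ ℤ ℂ) (n : ℤ) (l : ℕ) : ℝ :=
  ∑' k : ℤ, randomVar B n k ^ l * prob n k

/-- The `n`-th noise sequence `l ↦ s_n^B(l)` of `B`. -/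
def noiseSequence (B : Matrix ℤ ℤ ℂ) (n : ℤ) (l : ℕ) : ℝ :=
  matrixMoment oneMatrix n l - matrixMoment B n l

/-- `B` is noiseless if all its noise sequences vanish. -/
def IsNoiselessMatrix (B : Matrix ℤ ℤ ℂ) : Prop :=
  ∀ (n : ℤ) (l : ℕ), noiseSequence B n l = 0

theorem summable_prob (n : ℤ) : Summable (prob n) := by
  have h : Summable fun m : ℤ => 3 / Real.pi ^ 2 * (1 / (m : ℝ) ^ 2) :=
    (Real.summable_one_div_int_pow.2 one_lt_two).mul_left _
  refine (((Equiv.subRight n).summable_iff).2 h).congr fun k => ?_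
  simp only [Function.comp_apply, Equiv.subRight_apply, prob]
  split_ifs with hk
  · simp [hk]
  · push_cast; rw [div_mul_div_comm, mul_one]

/-- For entries in the unit disc, the vanishing of all noise sequences already follows if
`s_n^B(l₀) = 0` for all `n` and a single `l₀ ≥ 1`. -/
theorem isNoiselessMatrix_iff {B : Matrix ℤ ℤ ℂ} (hB : ∀ k l, ‖B k l‖ ≤ 1) :
    IsNoiselessMatrix B ↔ ∃ l₀ : ℕ, 1 ≤ l₀ ∧ ∀ n : ℤ, noiseSequence B n l₀ = 0 := by
  refine ⟨fun h => ⟨1, le_rfl, fun n => h n 1⟩, ?_⟩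
  rintro ⟨l₀, hl₀, h⟩
  have hp : ∀ n k, 0 ≤ prob n k := fun n k => by
    rw [prob]; split_ifs
    · exact le_rfl
    · positivity
  have hc : 0 < Real.pi / √3 := by positivity
  have hX0 : ∀ (C : Matrix ℤ ℤ ℂ) n k, 0 ≤ randomVar C n k := fun C n k => by
    rw [randomVar]; split_ifs
    · exact le_rfl
    · positivity
  have hone : ∀ k l, ‖oneMatrix k l‖ ≤ 1 := oneMatrix_isNormalizedPSD.norm_le_one
  have hX1 : ∀ (C : Matrix ℤ ℤ ℂ), (∀ k l, ‖C k l‖ ≤ 1) → ∀ n k,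
      randomVar C n k ≤ Real.pi / √3 := fun C hC n k => by
    rw [randomVar]; split_ifs
    · exact hc.le
    · exact mul_le_of_le_one_right hc.le (hC n k)
  have hsum : ∀ (C : Matrix ℤ ℤ ℂ), (∀ k l, ‖C k l‖ ≤ 1) → ∀ n,
      Summable fun k => randomVar C n k ^ l₀ * prob n k := fun C hC n =>
    Summable.of_nonneg_of_le (fun k => mul_nonneg (pow_nonneg (hX0 C n k) _) (hp n k))
      (fun k => mul_le_mul_of_nonneg_right
        (pow_le_pow_left₀ (hX0 C n k) (hX1 C hC n k) l₀) (hp n k))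
      ((summable_prob n).mul_left _)
  have hle : ∀ n k, randomVar B n k ≤ randomVar oneMatrix n k := fun n k => by
    rw [randomVar, randomVar]; split_ifs
    · exact le_rfl
    · exact mul_le_mul_of_nonneg_left ((hB n k).trans_eq (by simp [oneMatrix])) hc.le
  have heq : ∀ n k, randomVar B n k = randomVar oneMatrix n k := by
    intro n k
    by_cases hk : k = n
    · simp [randomVar, hk]
    have hz : ∑' j, (randomVar oneMatrix n j ^ l₀ * prob n j - randomVar B n j ^ l₀ * prob n j)
        = 0 := by
      rw [(hsum _ hone n).tsum_sub (hsum _ hB n)]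
      exact h n
    have h0 := (hasSum_zero_iff_of_nonneg (fun j => sub_nonneg.2 (mul_le_mul_of_nonneg_right
      (pow_le_pow_left₀ (hX0 B n j) (hle n j) l₀) (hp n j)))).1
      (hz ▸ ((hsum _ hone n).sub (hsum _ hB n)).hasSum)
    have h1 := sub_eq_zero.1 (congrFun h0 k)
    have hpk : prob n k ≠ 0 := by
      have : (k : ℝ) - n ≠ 0 := sub_ne_zero.2 (by exact_mod_cast hk)
      rw [prob, if_neg hk]; positivity
    exact ((pow_left_inj₀ (hX0 _ n k) (hX0 _ n k) (by omega)).1 (mul_right_cancel₀ hpk h1)).symm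
  intro n l
  simp [noiseSequence, matrixMoment, heq]

end BoxLocalization

end

/- Let `c k m` be the matrix entries of `E¹[1]`, so that `E^B[1]` has entries `B k m * c k m`. By
Parseval's identity for the functions `x e^{ikx}` on `[0, 2π)`, the noise operator of `E^B` has
entries `∑ₘ (B k l - B k m * B m l) * c k m * c m l`. On the diagonal this is
`∑ₘ (1 - |B k m|²) * |c k m|²`, and `c k m ≠ 0` for `m ≠ k`, so vanishing noise forces
`|B k m| = 1`. Conversely a positive semidefinite matrix of unimodular entries is a rank one matrix
of phases, `B k m * B m l = B k l`; the diagonal unitary with entries `B 0 k` then commutes with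
every `V_x` and carries `E^B` to `E¹`. Noise is a unitary invariant and `E¹` has none. Finally
`s_n^B(l)` is a sum of the nonnegative terms `(π/√3)^l * (1 - |B n k|^l) * p_n(k)`, so it vanishes
for `l = 1` precisely when the `n`-th row of `B` is unimodular. -/

open MeasureTheory
open scoped InnerProductSpace ComplexOrder

noncomputable section

namespace BoxLocalization

theorem sum_mul_integral_eq_integral_mul {α ι : Type*} [MeasurableSpace α] [Fintype ι]
    {μ : Measure α} [SigmaFinite μ] {ν : ι → Measure α} [∀ i, IsFiniteMeasure (ν i)] {a : ι → ℂ}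
    {h : α → ℂ} (hh : Integrable h μ)
    (hν : ∀ X, MeasurableSet X → ∑ i, a i * ((ν i).real X : ℂ) = ∫ x in X, h x ∂μ)
    {f : α → ℂ} (hf : ∀ i, Integrable f (ν i)) :
    ∑ i, a i * ∫ x, f x ∂ν i = ∫ x, f x * h x ∂μ := by
  set ρ : Measure α := μ + Measure.sum ν
  have hμρ : μ ≪ ρ := Measure.AbsolutelyContinuous.rfl.add_right _
  have hνρ : ∀ i, ν i ≪ ρ := fun i => by
    rw [show ρ = Measure.sum ν + μ from add_comm _ _]
    exact (Measure.absolutelyContinuous_sum_right i .rfl).add_right _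
  have hdi : ∀ i, Integrable (fun x => a i * (((ν i).rnDeriv ρ x).toReal : ℂ)) ρ := fun i =>
    Measure.integrable_toReal_rnDeriv.ofReal.const_mul _
  have hdens : (fun x => ∑ i, a i * (((ν i).rnDeriv ρ x).toReal : ℂ)) =ᵐ[ρ]
      fun x => (μ.rnDeriv ρ x).toReal • h x := by
    refine Integrable.ae_eq_of_forall_setIntegral_eq _ _ (integrable_finsetSum _ fun i _ => hdi i)
      ((integrable_rnDeriv_smul_iff hμρ).2 hh) fun X hX _ => ?_
    rw [integral_finsetSum _ fun i _ => (hdi i).integrableOn, setIntegral_rnDeriv_smul hμρ hX,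
      ← hν X hX]
    refine Finset.sum_congr rfl fun i _ => ?_
    rw [integral_const_mul, integral_complex_ofReal, Measure.setIntegral_toReal_rnDeriv (hνρ i)]
  calc ∑ i, a i * ∫ x, f x ∂ν i
      = ∑ i, ∫ x, a i * (((ν i).rnDeriv ρ x).toReal • f x) ∂ρ := by
        simp only [integral_const_mul, integral_rnDeriv_smul (hνρ _)]
    _ = ∫ x, ∑ i, a i * (((ν i).rnDeriv ρ x).toReal • f x) ∂ρ :=
        (integral_finsetSum _ fun i _ =>
          ((integrable_rnDeriv_smul_iff (hνρ i)).2 (hf i)).const_mul _).symm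
    _ = ∫ x, (μ.rnDeriv ρ x).toReal • (f x * h x) ∂ρ :=
        integral_congr_ae <| hdens.mono fun x hx => by
          simp only [Complex.real_smul, ← mul_assoc] at hx ⊢
          rw [mul_right_comm, ← hx, Finset.sum_mul]
    _ = ∫ x, f x * h x ∂μ := integral_rnDeriv_smul hμρ

theorem apply_mul_apply_eq_apply_of_posSemidef {n 𝕜 : Type*} [RCLike 𝕜] {A : Matrix n n 𝕜}
    (hA : A.PosSemidef) {l m : n} (hl : A l l = 1) (hm : A m m = 1) (h : ‖A m l‖ = 1) (k : n) :
    A k m * A m l = A k l := by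
  have hlm : A l m = star (A m l) := (hA.1.apply l m).symm
  have hone : star (A m l) * A m l = 1 := by
    rw [RCLike.star_def, RCLike.conj_mul, h, RCLike.ofReal_one, one_pow]
  -- `|l⟩ - A m l |m⟩` is isotropic, hence in the kernel; its image has `k`-th entry
  -- `A k l - A k m * A m l`.
  have hker : (A.submatrix ![k, l, m] ![k, l, m]).mulVec ![0, 1, -A m l] = 0 := by
    rw [← (hA.submatrix _).dotProduct_mulVec_zero_iff]
    simp only [dotProduct, Matrix.mulVec, Fin.sum_univ_three, Matrix.submatrix_apply,
      Pi.star_apply, Matrix.cons_val_zero, Matrix.cons_val_one, Matrix.cons_val, hl, hm, hlm,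
      star_zero, star_one, star_neg]
    linear_combination (-1 : 𝕜) * hone
  have hk := congrFun hker 0
  simp only [dotProduct, Matrix.mulVec, Fin.sum_univ_three, Matrix.submatrix_apply,
    Matrix.cons_val_zero, Matrix.cons_val_one, Matrix.cons_val, Pi.zero_apply] at hk
  linear_combination -hk

theorem exists_linearIsometryEquiv_apply_eq_smul {ι 𝕜 E : Type*} [RCLike 𝕜]
    [NormedAddCommGroup E] [InnerProductSpace 𝕜 E] [CompleteSpace E] (b : HilbertBasis ι 𝕜 E)
    {c : ι → 𝕜} (hc : ∀ i, ‖c i‖ = 1) : ∃ U : E ≃ₗᵢ[𝕜] E, ∀ i, U (b i) = c i • b i := by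
  classical
  have hortho : Orthonormal 𝕜 fun i => c i • b i := by
    refine ⟨fun i => by rw [norm_smul, hc, one_mul, b.orthonormal.1], fun i j hij => ?_⟩
    simp only [inner_smul_left, inner_smul_right, b.orthonormal.2 hij, mul_zero]
  have hspan : ⊤ ≤ (Submodule.span 𝕜 (Set.range fun i => c i • b i)).topologicalClosure := by
    rw [← b.dense_span]
    refine Submodule.topologicalClosure_mono (Submodule.span_le.2 ?_)
    rintro _ ⟨i, rfl⟩
    have hci : c i ≠ 0 := norm_ne_zero_iff.1 ((hc i).trans_ne one_ne_zero)
    rw [← inv_smul_smul₀ hci (b i)]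
    exact Submodule.smul_mem _ _ (Submodule.subset_span ⟨i, rfl⟩)
  refine ⟨b.repr.trans (HilbertBasis.mk hortho hspan).repr.symm, fun i => ?_⟩
  rw [LinearIsometryEquiv.trans_apply, b.repr_self, HilbertBasis.repr_symm_single,
    HilbertBasis.coe_mk]

theorem memLp_restrict_Ioc_of_continuous {E : Type*} [NormedAddCommGroup E] {f : ℝ → E}
    (hf : Continuous f) (p : ENNReal) (a c : ℝ) : MemLp f p (volume.restrict (Set.Ioc a c)) := by
  obtain ⟨C, hC⟩ := (isCompact_Icc (a := a) (b := c)).exists_bound_of_continuousOn hf.continuousOn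
  exact MemLp.of_bound hf.aestronglyMeasurable C
    (ae_restrict_of_forall_mem measurableSet_Ioc fun x hx => hC x (Set.Ioc_subset_Icc_self hx))

theorem hasSum_conj_fourierCoeffOn_mul_fourierCoeffOn {a c : ℝ} (hac : a < c) {f g : ℝ → ℂ}
    (hf : MemLp f 2 (volume.restrict (Set.Ioc a c)))
    (hg : MemLp g 2 (volume.restrict (Set.Ioc a c))) :
    HasSum (fun i => (starRingEnd ℂ) (fourierCoeffOn hac f i) * fourierCoeffOn hac g i)
      ((c - a)⁻¹ • ∫ x in a..c, (starRingEnd ℂ) (f x) * g x) := by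
  have := Fact.mk (sub_pos.2 hac)
  rw [← add_sub_cancel a c] at hf hg
  have hF := hf.memLp_liftIoc.haarAddCircle
  have hG := hg.memLp_liftIoc.haarAddCircle
  have hcoeff : ∀ {f : ℝ → ℂ} (hF : MemLp (AddCircle.liftIoc (c - a) a f) 2
      AddCircle.haarAddCircle) (i : ℤ), ⟪fourierBasis i, hF.toLp⟫_ℂ = fourierCoeffOn hac f i :=
    fun hF i => by
      rw [← HilbertBasis.repr_apply_apply, fourierBasis_repr,
        fourierCoeff_congr_ae hF.coeFn_toLp, fourierCoeff_liftIoc_eq]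
      simp only [add_sub_cancel]
  have hinner : ⟪hF.toLp, hG.toLp⟫_ℂ =
      (c - a)⁻¹ • ∫ x in a..a + (c - a), (starRingEnd ℂ) (f x) * g x := by
    rw [L2.inner_def, ← AddCircle.integral_liftIoc_eq_intervalIntegral,
      ← AddCircle.integral_haarAddCircle]
    refine integral_congr_ae ?_
    filter_upwards [hF.coeFn_toLp, hG.coeFn_toLp] with x hx hy
    rw [hx, hy, RCLike.inner_apply, mul_comm]
    rfl
  rw [add_sub_cancel] at hinner
  rw [← hinner]
  refine (fourierBasis.hasSum_inner_mul_inner _ _).congr_fun fun i => ?_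
  rw [← inner_conj_symm, hcoeff, hcoeff]

section Moments

theorem inner_apply_eq_sum_inner_apply_self {E : Type*} [SeminormedAddCommGroup E]
    [InnerProductSpace ℂ E] (T : E →ₗ[ℂ] E) (φ ψ : E) :
    ⟪φ, T ψ⟫_ℂ = ∑ k : Fin 4, (-Complex.I) ^ (k : ℕ) / 4 *
      ⟪φ + Complex.I ^ (k : ℕ) • ψ, T (φ + Complex.I ^ (k : ℕ) • ψ)⟫_ℂ := by
  have hI : Complex.I ^ 3 = -Complex.I := by rw [pow_succ, Complex.I_sq, neg_one_mul]
  simp only [Fin.sum_univ_four, Fin.coe_ofNat_eq_mod, Nat.reduceMod, pow_zero, pow_one, hI,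
    neg_sq, Complex.I_sq, Odd.neg_pow (by decide : Odd 3), neg_neg, map_add, map_smul,
    inner_add_left, inner_add_right, inner_smul_left, inner_smul_right, map_neg, map_one,
    Complex.conj_I]
  ring_nf
  simp only [Complex.I_sq]
  ring

variable {H : Type*} [NormedAddCommGroup H] [InnerProductSpace ℂ H]

theorem SemispectralMeasure.ofReal_measure_real (E : SemispectralMeasure H) (φ : H) {X : Set Box}
    (hX : MeasurableSet X) : (((E.measure φ).real X : ℝ) : ℂ) = ⟪φ, E.op X φ⟫_ℂ := by
  rw [Measure.real, E.measure_apply φ hX, ENNReal.toReal_ofReal (E.re_inner_nonneg φ X)]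
  exact (RCLike.nonneg_iff_exists_ofReal.1 ((E.op_pos X hX).inner_nonneg_right φ)).elim
    fun r hr => by rw [← hr.2]; rfl

theorem integrable_box_coe_pow (μ : Measure Box) [IsFiniteMeasure μ] (j : ℕ) :
    Integrable (fun x : Box => ((x : ℝ) : ℂ) ^ j) μ := by
  refine Integrable.of_bound (by fun_prop) ((2 * Real.pi) ^ j) (.of_forall fun x => ?_)
  rw [norm_pow, Complex.norm_real, Real.norm_of_nonneg x.2.1]
  exact pow_le_pow_left₀ x.2.1 x.2.2.le j

variable [CompleteSpace H]

theorem SemispectralMeasure.inner_moment_eq_integral (E : SemispectralMeasure H) {φ ψ : H}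
    {h : Box → ℂ} (hh : Integrable h)
    (hE : ∀ X, MeasurableSet X → ⟪φ, E.op X ψ⟫_ℂ = ∫ x in X, h x) (j : ℕ) :
    ⟪φ, E.moment j ψ⟫_ℂ = ∫ x : Box, ((x : ℝ) : ℂ) ^ j * h x := by
  rw [← sum_mul_integral_eq_integral_mul hh
    (ν := fun k : Fin 4 => E.measure (φ + Complex.I ^ (k : ℕ) • ψ)) (fun X hX => ?_)
    fun k => integrable_box_coe_pow _ j]
  · refine (inner_apply_eq_sum_inner_apply_self (E.moment j : H →ₗ[ℂ] H) φ ψ).trans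
      (Finset.sum_congr rfl fun k _ => congrArg _ ?_)
    refine (E.inner_moment j _).trans ?_
    rw [← integral_complex_ofReal]
    simp only [Complex.ofReal_pow]
  · rw [← hE X hX]
    refine Eq.symm <| (inner_apply_eq_sum_inner_apply_self (E.op X : H →ₗ[ℂ] H) φ ψ).trans
      (Finset.sum_congr rfl fun k _ => congrArg _ (E.ofReal_measure_real _ hX).symm)

end Moments

/-- `(2π)⁻¹ ∫ x^j e^{i(k-l)x} dx`, the matrix of the `j`-th moment of the canonical observable;
`boxFourier Set.univ` is the case `j = 0`. -/
def boxMoment (j : ℕ) (k l : ℤ) : ℂ :=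
  (1 / (2 * Real.pi) : ℂ) *
    ∫ x : Box, ((x : ℝ) : ℂ) ^ j * Complex.exp (Complex.I * ((k : ℂ) - l) * ((x : ℝ) : ℂ))

theorem boxMoment_eq_intervalIntegral (j : ℕ) (k l : ℤ) :
    boxMoment j k l = (2 * Real.pi)⁻¹ •
      ∫ x in (0 : ℝ)..(2 * Real.pi), (x : ℂ) ^ j * Complex.exp (Complex.I * ((k : ℂ) - l) * x) := by
  rw [boxMoment, intervalIntegral.integral_of_le (by positivity), ← integral_Ico_eq_integral_Ioc,
    ← integral_subtype measurableSet_Ico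
      (fun x : ℝ => (x : ℂ) ^ j * Complex.exp (Complex.I * ((k : ℂ) - l) * (x : ℂ))),
    Complex.real_smul, one_div]
  push_cast
  rfl

theorem conj_boxMoment (j : ℕ) (k l : ℤ) :
    (starRingEnd ℂ) (boxMoment j k l) = boxMoment j l k := by
  rw [boxMoment, boxMoment, map_mul, ← integral_conj]
  simp only [map_div₀, map_mul, map_pow, map_sub, map_one, Complex.conj_ofReal, Complex.conj_I,
    Complex.conj_ofNat, map_intCast, ← Complex.exp_conj, neg_mul, ← mul_neg, neg_sub]

theorem boxMoment_one_of_ne {k l : ℤ} (hkl : k ≠ l) :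
    boxMoment 1 k l = (Complex.I * ((k : ℂ) - l))⁻¹ := by
  set c : ℂ := Complex.I * ((k : ℂ) - l) with hc
  have hc₀ : c ≠ 0 := mul_ne_zero Complex.I_ne_zero (sub_ne_zero.2 (Int.cast_injective.ne hkl))
  have hpi : (Real.pi : ℂ) ≠ 0 := Complex.ofReal_ne_zero.2 Real.pi_ne_zero
  have hderiv : ∀ x : ℝ, HasDerivAt (fun x : ℝ => (x / c - 1 / c ^ 2) * Complex.exp (c * x))
      ((x : ℂ) ^ 1 * Complex.exp (c * x)) x := fun x => by
    have hx : HasDerivAt (fun x : ℝ => (x : ℂ)) 1 x := Complex.ofRealCLM.hasDerivAt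
    refine (((hx.div_const c).sub_const _).mul (hx.const_mul c).cexp).congr_deriv ?_
    field_simp
    ring
  have hperiod : Complex.exp (c * ((2 * Real.pi : ℝ) : ℂ)) = 1 :=
    Complex.exp_eq_one_iff.2 ⟨k - l, by rw [hc]; push_cast; ring⟩
  rw [boxMoment_eq_intervalIntegral, intervalIntegral.integral_eq_sub_of_hasDerivAt
    (fun x _ => hderiv x) (Continuous.intervalIntegrable (by fun_prop) _ _), hperiod,
    Complex.real_smul, Complex.ofReal_zero, mul_zero, Complex.exp_zero]
  push_cast
  field_simp
  ring

theorem fourierCoeffOn_mul_exp (k m : ℤ) :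
    fourierCoeffOn Real.two_pi_pos (fun x => (x : ℂ) * Complex.exp (Complex.I * k * x)) m =
      boxMoment 1 k m := by
  have hpi : (Real.pi : ℂ) ≠ 0 := Complex.ofReal_ne_zero.2 Real.pi_ne_zero
  rw [fourierCoeffOn_eq_integral, boxMoment_eq_intervalIntegral, sub_zero, one_div]
  congr 1
  refine intervalIntegral.integral_congr fun x _ => ?_
  simp only [smul_eq_mul, pow_one]
  rw [fourier_coe_apply, mul_left_comm, ← Complex.exp_add]
  congr 2
  push_cast
  field_simp
  ring

/- `E¹[2] = E¹[1]²` in matrix form: Parseval's identity for `x e^{ikx}` and `x e^{ilx}`. -/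
theorem hasSum_boxMoment_one_mul_boxMoment_one (k l : ℤ) :
    HasSum (fun m => boxMoment 1 k m * boxMoment 1 m l) (boxMoment 2 k l) := by
  have hL2 : ∀ k : ℤ, MemLp (fun x : ℝ => (x : ℂ) * Complex.exp (Complex.I * k * x)) 2
      (volume.restrict (Set.Ioc 0 (2 * Real.pi))) := fun k =>
    memLp_restrict_Ioc_of_continuous (by fun_prop) _ _ _
  have hinner : ∀ x : ℝ, (starRingEnd ℂ) (x * Complex.exp (Complex.I * l * x)) *
      (x * Complex.exp (Complex.I * k * x)) =
        (x : ℂ) ^ 2 * Complex.exp (Complex.I * ((k : ℂ) - l) * x) := fun x => by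
    simp only [map_mul, ← Complex.exp_conj, Complex.conj_ofReal, Complex.conj_I, map_intCast]
    rw [mul_mul_mul_comm, ← Complex.exp_add, sq]
    ring_nf
  have h := hasSum_conj_fourierCoeffOn_mul_fourierCoeffOn Real.two_pi_pos (hL2 l) (hL2 k)
  simp only [hinner, sub_zero, ← boxMoment_eq_intervalIntegral, fourierCoeffOn_mul_exp,
    conj_boxMoment] at h
  exact h.congr_fun fun m => mul_comm _ _

namespace IsStructureMatrix

variable {H : Type*} [NormedAddCommGroup H] [InnerProductSpace ℂ H]
  {b : HilbertBasis ℤ ℂ H} {E : SemispectralMeasure H} {B : Matrix ℤ ℤ ℂ}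

theorem mul_apply_of_norm_eq_one (hB : IsStructureMatrix b E B) (h : ∀ k l, ‖B k l‖ = 1)
    (k m l : ℤ) : B k m * B m l = B k l :=
  apply_mul_apply_eq_apply_of_posSemidef hB.normalizedPSD.posSemidef (hB.normalizedPSD.diag l)
    (hB.normalizedPSD.diag m) (h m l) k

variable [CompleteSpace H]

theorem inner_moment (hB : IsStructureMatrix b E B) (j : ℕ) (k l : ℤ) :
    ⟪b k, E.moment j (b l)⟫_ℂ = B k l * boxMoment j k l := by
  have hexp : Integrable fun x : Box =>
      Complex.exp (Complex.I * ((k : ℂ) - l) * ((x : ℝ) : ℂ)) :=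
    integrableOn_univ.1 (integrable_exp Set.univ k l)
  rw [E.inner_moment_eq_integral (hexp.const_mul (B k l * (1 / (2 * Real.pi))))
    (fun X hX => by rw [hB.inner_op X hX, boxFourier, integral_const_mul, mul_assoc]) j]
  rw [boxMoment, ← mul_assoc, ← integral_const_mul]
  simp only [mul_left_comm]

theorem hasSum_inner_noise (hB : IsStructureMatrix b E B) (k l : ℤ) :
    HasSum (fun m => (B k l - B k m * B m l) * (boxMoment 1 k m * boxMoment 1 m l))
      ⟪b k, E.noise (b l)⟫_ℂ := by
  have hcomp := b.hasSum_inner_mul_inner (ContinuousLinearMap.adjoint (E.moment 1) (b k))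
    (E.moment 1 (b l))
  simp only [ContinuousLinearMap.adjoint_inner_left, hB.inner_moment] at hcomp
  have hsq := ((hasSum_boxMoment_one_mul_boxMoment_one k l).mul_left (B k l)).sub hcomp
  rw [SemispectralMeasure.noise, _root_.sub_apply, inner_sub_right,
    ContinuousLinearMap.comp_apply, hB.inner_moment]
  exact hsq.congr_fun fun m => by ring

theorem norm_eq_one_of_isNoiseless (hB : IsStructureMatrix b E B) (hE : E.IsNoiseless)
    (k l : ℤ) : ‖B k l‖ = 1 := by
  obtain rfl | hkl := eq_or_ne k l
  · rw [hB.normalizedPSD.diag, norm_one]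
  have hnoise : HasSum (fun m => (1 - ‖B k m‖ ^ 2) * ‖boxMoment 1 k m‖ ^ 2) 0 := by
    have h := hB.hasSum_inner_noise k k
    rw [hE, _root_.zero_apply, inner_zero_right] at h
    refine Complex.hasSum_ofReal.1 (h.congr_fun fun m => ?_)
    rw [← conj_boxMoment 1 k m, ← hB.normalizedPSD.posSemidef.1.apply m k, hB.normalizedPSD.diag,
      Complex.star_def, Complex.mul_conj', Complex.mul_conj']
    push_cast
    rfl
  have hnonneg : ∀ m, 0 ≤ (1 - ‖B k m‖ ^ 2) * ‖boxMoment 1 k m‖ ^ 2 := fun m =>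
    mul_nonneg (sub_nonneg.2 (pow_le_one₀ (norm_nonneg _) (hB.normalizedPSD.norm_le_one k m)))
      (sq_nonneg _)
  have hmoment : ‖boxMoment 1 k l‖ ^ 2 ≠ 0 := by
    rw [boxMoment_one_of_ne hkl]
    exact pow_ne_zero _ (norm_ne_zero_iff.2 (inv_ne_zero
      (mul_ne_zero Complex.I_ne_zero (sub_ne_zero.2 (Int.cast_injective.ne hkl)))))
  have hl : (1 - ‖B k l‖ ^ 2) * ‖boxMoment 1 k l‖ ^ 2 = 0 :=
    congrFun ((hasSum_zero_iff_of_nonneg hnonneg).1 hnoise) l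
  exact (pow_eq_one_iff_of_nonneg (norm_nonneg _) two_ne_zero).1
    (sub_eq_zero.1 ((mul_eq_zero.1 hl).resolve_right hmoment)).symm

theorem isNoiseless_of_norm_eq_one (hB : IsStructureMatrix b E B) (h : ∀ k l, ‖B k l‖ = 1) :
    E.IsNoiseless := by
  refine ext_matrix b fun k l => ?_
  rw [_root_.zero_apply, inner_zero_right]
  refine (hB.hasSum_inner_noise k l).unique ?_
  simp only [hB.mul_apply_of_norm_eq_one h, sub_self, zero_mul]
  exact hasSum_zero

end IsStructureMatrix

section Conjugation

variable {H : Type*} [NormedAddCommGroup H] [InnerProductSpace ℂ H]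

theorem inner_conjugate (U : H ≃ₗᵢ[ℂ] H) (T : H →L[ℂ] H) (φ ψ : H) :
    ⟪φ, conjugate U T ψ⟫_ℂ = ⟪U.symm φ, T (U.symm ψ)⟫_ℂ :=
  (U.symm.inner_map_eq_flip φ (T (U.symm ψ))).symm

theorem inner_conjugate_of_apply_eq_smul {ι : Type*} {c : ι → ℂ} {b : ι → H}
    {U : H ≃ₗᵢ[ℂ] H} (hc : ∀ i, ‖c i‖ = 1) (hU : ∀ i, U (b i) = c i • b i) (T : H →L[ℂ] H)
    (i j : ι) :
    ⟪b i, conjugate U T (b j)⟫_ℂ = c i * (starRingEnd ℂ) (c j) * ⟪b i, T (b j)⟫_ℂ := by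
  have hsymm : ∀ i, U.symm (b i) = (starRingEnd ℂ) (c i) • b i := fun i => by
    rw [LinearIsometryEquiv.symm_apply_eq, map_smul, hU, smul_smul, Complex.conj_mul', hc,
      Complex.ofReal_one, one_pow, one_smul]
  rw [inner_conjugate, hsymm, hsymm, map_smul, inner_smul_left, inner_smul_right,
    Complex.conj_conj, mul_assoc]

variable [CompleteSpace H]

theorem conjugate_eq_conjStarAlgEquiv (U : H ≃ₗᵢ[ℂ] H) (T : H →L[ℂ] H) :
    conjugate U T = U.conjStarAlgEquiv T := rfl

variable {E F : SemispectralMeasure H} {U : H ≃ₗᵢ[ℂ] H}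

theorem conjugate_moment (h : ∀ X, MeasurableSet X → conjugate U (E.op X) = F.op X) (j : ℕ) :
    conjugate U (E.moment j) = F.moment j := by
  have hmeasure : ∀ φ, E.measure (U.symm φ) = F.measure φ := fun φ => by
    ext X hX
    rw [E.measure_apply _ hX, F.measure_apply _ hX, ← h X hX, inner_conjugate]
  have hinner : ∀ φ, ⟪φ, conjugate U (E.moment j) φ⟫_ℂ = ⟪φ, F.moment j φ⟫_ℂ := fun φ => by
    rw [inner_conjugate, E.inner_moment, F.inner_moment, hmeasure]
  refine ContinuousLinearMap.coe_injective ((ext_inner_map _ _).1 fun φ => ?_)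
  rw [← inner_conj_symm, ← inner_conj_symm _ φ]
  exact congrArg _ (hinner φ)

theorem conjugate_noise (h : ∀ X, MeasurableSet X → conjugate U (E.op X) = F.op X) :
    conjugate U E.noise = F.noise := by
  rw [SemispectralMeasure.noise, SemispectralMeasure.noise, ← conjugate_moment h,
    ← conjugate_moment h]
  simp only [conjugate_eq_conjStarAlgEquiv, ← ContinuousLinearMap.mul_def, map_sub, map_mul]

theorem isNoiseless_iff_of_conjugate_eq
    (h : ∀ X, MeasurableSet X → conjugate U (E.op X) = F.op X) :
    E.IsNoiseless ↔ F.IsNoiseless := by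
  rw [SemispectralMeasure.IsNoiseless, SemispectralMeasure.IsNoiseless, ← conjugate_noise h,
    conjugate_eq_conjStarAlgEquiv, EmbeddingLike.map_eq_zero_iff]

theorem isNoiseless_canonicalObservable (b : HilbertBasis ℤ ℂ H) :
    (canonicalObservable b).IsNoiseless :=
  (boxObservable_isStructureMatrix b _ oneMatrix_isNormalizedPSD).isNoiseless_of_norm_eq_one
    fun _ _ => norm_one

theorem IsStructureMatrix.isUnitarilyEquivalent_of_norm_eq_one {b : HilbertBasis ℤ ℂ H}
    {B : Matrix ℤ ℤ ℂ} (hB : IsStructureMatrix b E B) (h : ∀ k l, ‖B k l‖ = 1) :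
    IsUnitarilyEquivalent b E (canonicalObservable b) := by
  have hE₁ : IsStructureMatrix b (canonicalObservable b) oneMatrix :=
    boxObservable_isStructureMatrix b _ oneMatrix_isNormalizedPSD
  have hconj : ∀ k l, (starRingEnd ℂ) (B k l) = B l k := fun k l =>
    hB.normalizedPSD.posSemidef.1.apply l k
  have hone : ∀ k l, B 0 k * B l 0 * B k l = 1 := fun k l => by
    rw [mul_right_comm, hB.mul_apply_of_norm_eq_one h, hB.mul_apply_of_norm_eq_one h,
      hB.normalizedPSD.diag]
  obtain ⟨U, hU⟩ := exists_linearIsometryEquiv_apply_eq_smul b (h 0)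
  refine ⟨U, fun X hX => ext_matrix b fun k l => ?_, fun x => ext_matrix b fun k l => ?_⟩
  · rw [inner_conjugate_of_apply_eq_smul (h 0) hU, hconj, hB.inner_op X hX, hE₁.inner_op X hX,
      ← mul_assoc, hone]
    rfl
  · rw [inner_conjugate_of_apply_eq_smul (h 0) hU, hconj]
    obtain rfl | hkl := eq_or_ne k l
    · rw [hB.mul_apply_of_norm_eq_one h, hB.normalizedPSD.diag, one_mul]
    · have hdiag : ⟪b k, (translation b x : H →L[ℂ] H) (b l)⟫_ℂ = 0 := by
        refine (congrArg _ (translation_apply b x l)).trans ?_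
        rw [inner_smul_right, b.orthonormal.2 hkl, mul_zero]
      rw [hdiag, mul_zero]

end Conjugation

theorem prob_nonneg (n k : ℤ) : 0 ≤ prob n k := by
  rw [prob]
  split_ifs <;> positivity

theorem prob_pos_of_ne {n k : ℤ} (hk : k ≠ n) : 0 < prob n k := by
  have : (k : ℝ) - n ≠ 0 := sub_ne_zero.2 (Int.cast_injective.ne hk)
  rw [prob, if_neg hk]
  positivity

theorem randomVar_pow_mul_prob (B : Matrix ℤ ℤ ℂ) (n k : ℤ) (l : ℕ) :
    randomVar B n k ^ l * prob n k = ‖B n k‖ ^ l * ((Real.pi / √3) ^ l * prob n k) := by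
  obtain rfl | hk := eq_or_ne k n
  · simp only [prob, if_pos, mul_zero]
  · rw [randomVar, if_neg hk, mul_pow, mul_left_comm, mul_assoc]

theorem hasSum_noiseSequence {B : Matrix ℤ ℤ ℂ} {n : ℤ} (hB : ∀ k, ‖B n k‖ ≤ 1) (l : ℕ) :
    HasSum (fun k => (1 - ‖B n k‖ ^ l) * ((Real.pi / √3) ^ l * prob n k))
      (noiseSequence B n l) := by
  have hnonneg : ∀ k, 0 ≤ (Real.pi / √3) ^ l * prob n k := fun k =>
    mul_nonneg (by positivity) (prob_nonneg n k)
  have hmoment : ∀ C : Matrix ℤ ℤ ℂ, (∀ k, ‖C n k‖ ≤ 1) →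
      HasSum (fun k => ‖C n k‖ ^ l * ((Real.pi / √3) ^ l * prob n k)) (matrixMoment C n l) :=
    fun C hC => by
      simp only [matrixMoment, randomVar_pow_mul_prob]
      exact (Summable.of_nonneg_of_le
        (fun k => mul_nonneg (pow_nonneg (norm_nonneg _) l) (hnonneg k))
        (fun k => mul_le_of_le_one_left (hnonneg k) (pow_le_one₀ (norm_nonneg _) (hC k)))
        ((summable_prob n).mul_left _)).hasSum
  refine ((hmoment oneMatrix (oneMatrix_isNormalizedPSD.norm_le_one n)).sub
    (hmoment B hB)).congr_fun fun k => ?_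
  rw [oneMatrix, Matrix.of_apply, norm_one, one_pow, sub_mul]

theorem IsNormalizedPSD.isNoiselessMatrix_iff_norm_eq_one {B : Matrix ℤ ℤ ℂ}
    (hB : IsNormalizedPSD B) :
    IsNoiselessMatrix B ↔ ∀ k l, ‖B k l‖ = 1 := by
  refine ⟨fun h n k => ?_, fun h n l => ?_⟩
  · obtain rfl | hk := eq_or_ne k n
    · rw [hB.diag, norm_one]
    have hsum := hasSum_noiseSequence (hB.norm_le_one n) 1
    rw [h n 1, hasSum_zero_iff_of_nonneg fun k => mul_nonneg
      (sub_nonneg.2 (pow_le_one₀ (norm_nonneg _) (hB.norm_le_one n k)))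
      (mul_nonneg (by positivity) (prob_nonneg n k))] at hsum
    have hweight : (Real.pi / √3) ^ 1 * prob n k ≠ 0 :=
      mul_ne_zero (by positivity) (prob_pos_of_ne hk).ne'
    rw [← pow_one ‖B n k‖]
    exact (sub_eq_zero.1 ((mul_eq_zero.1 (congrFun hsum k)).resolve_right hweight)).symm
  · refine (hasSum_noiseSequence (hB.norm_le_one n) l).unique ?_
    simp only [h, one_pow, sub_self, zero_mul]
    exact hasSum_zero

end BoxLocalization

end

theorem corollary2 {H : Type*} [NormedAddCommGroup H] [InnerProductSpace ℂ H] [CompleteSpace H]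
    (b : HilbertBasis ℤ ℂ H) (E : BoxLocalization.SemispectralMeasure H)
    (hE : BoxLocalization.IsCovariant b E)
    (B : Matrix ℤ ℤ ℂ) (hB : BoxLocalization.IsStructureMatrix b E B) :
    List.TFAE [
      E.IsNoiseless,
      BoxLocalization.IsNoiselessMatrix B,
      ∀ k l : ℤ, ‖B k l‖ = 1,
      BoxLocalization.IsUnitarilyEquivalent b E (BoxLocalization.canonicalObservable b)] := by
  tfae_have 1 → 3 := hB.norm_eq_one_of_isNoiseless
  tfae_have 3 → 4 := hB.isUnitarilyEquivalent_of_norm_eq_one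
  tfae_have 4 → 1 := fun ⟨_, hU, _⟩ => (BoxLocalization.isNoiseless_iff_of_conjugate_eq hU).2
    (BoxLocalization.isNoiseless_canonicalObservable b)
  tfae_have 2 ↔ 3 := hB.normalizedPSD.isNoiselessMatrix_iff_norm_eq_one
  tfae_finish
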